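/- Let $k$ be a field and let $K$ be an algebraically closed field extension of $k$ (for instance $K=k$ when $k$ is algebraically closed). For a homogeneous polynomial $F\in k[X,Y,Z]$ let $V(F)\subseteq \mathbf{P}^2(K)$ denote the set of points of the projective plane over $K$ at which $F$ vanishes. **Theorem 9.4 (Chasles).** Let $F_1,F_2\in k[X,Y,Z]$ be nonzero homogeneous polynomials of degree $3$ such that the cubic curves $V(F_1)$ and $V(F_2)$ meet in exactly nine (distinct) points of $\mathbf{P}^2(K)$. Let $G\in k[X,Y,Z]$ be a nonzero homogeneous polynomial of degree $3$ such that $V(G)$ contains eight of these nine points. Then $V(G)$ contains the ninth as well, i.e. $V(F_1)\cap V(F_2)\subseteq V(G)$. -/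

import Mathlib

open scoped LinearAlgebra.Projectivization

/-- A ternary cubic form over `k`: a nonzero homogeneous polynomial of degree `3` in the three
homogeneous coordinates. Cubic plane curves over `k` are the vanishing loci of such forms. -/
def IsCubicForm {k : Type*} [Field k] (F : MvPolynomial (Fin 3) k) : Prop :=
  F ≠ 0 ∧ F.IsHomogeneous 3

/-- The points of the projective plane over `K` all of whose homogeneous coordinate vectors are
zeros of the polynomial `F`, whose coefficients lie in a subfield `k` of `K`. -/
def planeLocus {k : Type*} (K : Type*) [Field k] [Field K] [Algebra k K]
    (F : MvPolynomial (Fin 3) k) : Set (ℙ K (Fin 3 → K)) :=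
  {P | ∀ (v : Fin 3 → K) (hv : v ≠ 0), Projectivization.mk K v hv = P → MvPolynomial.aeval v F = 0}

/-- For a homogeneous form it is enough to test one homogeneous coordinate vector. -/
theorem mk_mem_planeLocus_iff {k K : Type*} [Field k] [Field K] [Algebra k K]
    {F : MvPolynomial (Fin 3) k} {n : ℕ} (hF : F.IsHomogeneous n)
    (v : Fin 3 → K) (hv : v ≠ 0) :
    Projectivization.mk K v hv ∈ planeLocus K F ↔ MvPolynomial.aeval v F = 0 := by
  refine ⟨fun h => h v hv rfl, fun h w hw hwv => ?_⟩
  obtain ⟨a, rfl⟩ := (Projectivization.mk_eq_mk_iff' K w v hw hv).1 hwv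
  have key : MvPolynomial.aeval (a • v) F = a ^ n * MvPolynomial.aeval v F := by
    simp only [MvPolynomial.aeval_def, MvPolynomial.eval₂_eq', Finset.mul_sum]
    refine Finset.sum_congr rfl fun d hd => ?_
    have hdeg : ∑ i, d i = n := by
      rw [← Finsupp.degree_eq_sum, Finsupp.degree_eq_weight_one]
      exact hF (MvPolynomial.mem_support_iff.1 hd)
    simp only [Pi.smul_apply, smul_eq_mul, mul_pow, Finset.prod_mul_distrib,
      Finset.prod_pow_eq_pow_sum, hdeg]
    ring
  rw [key, h, mul_zero]

/-! ### Ternary forms as coefficient vectors, and linear algebra in the plane. -/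

section PlaneForms

open scoped Matrix

variable {K : Type*} [Field K]

/-! Ternary cubic forms make up a ten-dimensional space. If the eight points impose independent
conditions on it, the cubics through them form a pencil, spanned by F₁ and F₂ (`cubic_mem_pencil`).
Then G is a combination of F₁ and F₂ over K and vanishes wherever both do.

Independence means that for each point some cubic passes through the other seven and misses it. Such
a cubic is a line times a conic (`exists_cubic_separating`), provided no four points are collinear
and no seven lie on a conic.

Both provisos are elementary cases of Bézout: a line meeting both cubics in four of the points, or,
once no four are collinear, a conic meeting them in seven, lies on both cubics. Its points,
parametrized by the infinite field K, would make the intersection infinite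
(`exists_family_of_collinear`, `exists_family_of_conic`). Likewise F₁ and F₂ are not proportional
over K, since a cubic curve has infinitely many points (`exists_family_of_cubic`). -/

/-- Evaluation at `v` of the ternary quadratic form with a given coefficient vector. -/
def conicEval (v : Fin 3 → K) : (Fin 6 → K) →ₗ[K] K where
  toFun c := c 0 * v 0 ^ 2 + c 1 * v 1 ^ 2 + c 2 * v 2 ^ 2 + c 3 * (v 1 * v 2) +
    c 4 * (v 0 * v 2) + c 5 * (v 0 * v 1)
  map_add' c d := by simp only [Pi.add_apply]; ring
  map_smul' a c := by simp only [Pi.smul_apply, smul_eq_mul, RingHom.id_apply]; ring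

/-- Evaluation at `v` of the ternary cubic form with a given coefficient vector. -/
def cubicEval (v : Fin 3 → K) : (Fin 10 → K) →ₗ[K] K where
  toFun c := c 0 * v 0 ^ 3 + c 1 * v 1 ^ 3 + c 2 * v 2 ^ 3 + c 3 * (v 0 ^ 2 * v 1) +
    c 4 * (v 0 ^ 2 * v 2) + c 5 * (v 0 * v 1 ^ 2) + c 6 * (v 1 ^ 2 * v 2) +
    c 7 * (v 0 * v 2 ^ 2) + c 8 * (v 1 * v 2 ^ 2) + c 9 * (v 0 * v 1 * v 2)
  map_add' c d := by simp only [Pi.add_apply]; ring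
  map_smul' a c := by simp only [Pi.smul_apply, smul_eq_mul, RingHom.id_apply]; ring

theorem conicEval_apply (v : Fin 3 → K) (c : Fin 6 → K) : conicEval v c =
    c 0 * v 0 ^ 2 + c 1 * v 1 ^ 2 + c 2 * v 2 ^ 2 + c 3 * (v 1 * v 2) +
    c 4 * (v 0 * v 2) + c 5 * (v 0 * v 1) := rfl

theorem cubicEval_apply (v : Fin 3 → K) (c : Fin 10 → K) : cubicEval v c =
    c 0 * v 0 ^ 3 + c 1 * v 1 ^ 3 + c 2 * v 2 ^ 3 + c 3 * (v 0 ^ 2 * v 1) +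
    c 4 * (v 0 ^ 2 * v 2) + c 5 * (v 0 * v 1 ^ 2) + c 6 * (v 1 ^ 2 * v 2) +
    c 7 * (v 0 * v 2 ^ 2) + c 8 * (v 1 * v 2 ^ 2) + c 9 * (v 0 * v 1 * v 2) := rfl

theorem cubicEval_smul (a : K) (v : Fin 3 → K) (c : Fin 10 → K) :
    cubicEval (a • v) c = a ^ 3 * cubicEval v c := by
  simp only [cubicEval_apply, Pi.smul_apply, smul_eq_mul]; ring

/-- The product of two linear forms is a quadratic form. -/
theorem exists_conicEval_eq_mul (m n : Fin 3 → K) :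
    ∃ c : Fin 6 → K, ∀ v, conicEval v c = m ⬝ᵥ v * n ⬝ᵥ v := by
  refine ⟨![m 0 * n 0, m 1 * n 1, m 2 * n 2, m 1 * n 2 + m 2 * n 1, m 0 * n 2 + m 2 * n 0,
    m 0 * n 1 + m 1 * n 0], fun v => ?_⟩
  simp [conicEval_apply, dotProduct, Fin.sum_univ_three]
  ring

/-- The product of a linear form and a quadratic form is a cubic form. -/
theorem exists_cubicEval_eq_mul (n : Fin 3 → K) (q : Fin 6 → K) :
    ∃ c : Fin 10 → K, ∀ v, cubicEval v c = n ⬝ᵥ v * conicEval v q := by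
  refine ⟨![n 0 * q 0, n 1 * q 1, n 2 * q 2, n 0 * q 5 + n 1 * q 0, n 0 * q 4 + n 2 * q 0,
    n 0 * q 1 + n 1 * q 5, n 1 * q 3 + n 2 * q 1, n 0 * q 2 + n 2 * q 4, n 1 * q 2 + n 2 * q 3,
    n 0 * q 3 + n 1 * q 4 + n 2 * q 5], fun v => ?_⟩
  simp [conicEval_apply, cubicEval_apply, dotProduct, Fin.sum_univ_three]
  ring

/-- The restriction of a quadratic form along a linear map is a quadratic form. -/
theorem exists_conicEval_comp (p q r : Fin 3 → K) (c : Fin 6 → K) :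
    ∃ d : Fin 6 → K, ∀ x y z : K,
      conicEval (x • p + y • q + z • r) c = conicEval ![x, y, z] d := by
  refine ⟨![conicEval p c, conicEval q c, conicEval r c,
    conicEval (q + r) c - conicEval q c - conicEval r c,
    conicEval (p + r) c - conicEval p c - conicEval r c,
    conicEval (p + q) c - conicEval p c - conicEval q c], fun x y z => ?_⟩
  simp [conicEval_apply]
  ring

/-- The directional derivative at `p` in the direction `q` of a cubic form. -/
def cubicPolar (p q : Fin 3 → K) (c : Fin 10 → K) : K :=
  3 * c 0 * p 0 ^ 2 * q 0 + 3 * c 1 * p 1 ^ 2 * q 1 + 3 * c 2 * p 2 ^ 2 * q 2 +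
  c 3 * (2 * p 0 * q 0 * p 1 + p 0 ^ 2 * q 1) + c 4 * (2 * p 0 * q 0 * p 2 + p 0 ^ 2 * q 2) +
  c 5 * (q 0 * p 1 ^ 2 + 2 * p 0 * p 1 * q 1) + c 6 * (2 * p 1 * q 1 * p 2 + p 1 ^ 2 * q 2) +
  c 7 * (q 0 * p 2 ^ 2 + 2 * p 0 * p 2 * q 2) + c 8 * (q 1 * p 2 ^ 2 + 2 * p 1 * p 2 * q 2) +
  c 9 * (q 0 * p 1 * p 2 + p 0 * q 1 * p 2 + p 0 * p 1 * q 2)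

/-- The restriction of a cubic form along a linear map is a cubic form. -/
theorem exists_cubicEval_comp (p q r : Fin 3 → K) (c : Fin 10 → K) :
    ∃ d : Fin 10 → K, ∀ x y z : K,
      cubicEval (x • p + y • q + z • r) c = cubicEval ![x, y, z] d := by
  -- The coefficient of `x ^ 2 * y` is a directional derivative, because extracting it from values
  -- would require division by 2. The coefficient of `x * y * z` comes from inclusion-exclusion.
  refine ⟨![cubicEval p c, cubicEval q c, cubicEval r c, cubicPolar p q c, cubicPolar p r c,
    cubicPolar q p c, cubicPolar q r c, cubicPolar r p c, cubicPolar r q c,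
    cubicEval (p + q + r) c - cubicEval (p + q) c - cubicEval (p + r) c - cubicEval (q + r) c +
      cubicEval p c + cubicEval q c + cubicEval r c], fun x y z => ?_⟩
  simp [cubicEval_apply, cubicPolar]
  ring

theorem exists_cubicEval_eq_monomial (a : K) {i j l : ℕ} (h : i + j + l = 3) :
    ∃ c : Fin 10 → K, ∀ v : Fin 3 → K, a * (v 0 ^ i * v 1 ^ j * v 2 ^ l) = cubicEval v c := by
  have hi : i ≤ 3 := by omega
  have hj : j ≤ 3 - i := by omega
  obtain rfl : l = 3 - i - j := by omega
  interval_cases i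
  · interval_cases j
    · exact ⟨Pi.single 2 a, fun v => by simp [cubicEval_apply]⟩
    · exact ⟨Pi.single 8 a, fun v => by simp [cubicEval_apply]⟩
    · exact ⟨Pi.single 6 a, fun v => by simp [cubicEval_apply]⟩
    · exact ⟨Pi.single 1 a, fun v => by simp [cubicEval_apply]⟩
  · interval_cases j
    · exact ⟨Pi.single 7 a, fun v => by simp [cubicEval_apply]⟩
    · exact ⟨Pi.single 9 a, fun v => by simp [cubicEval_apply]⟩
    · exact ⟨Pi.single 5 a, fun v => by simp [cubicEval_apply]⟩
  · interval_cases j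
    · exact ⟨Pi.single 4 a, fun v => by simp [cubicEval_apply]⟩
    · exact ⟨Pi.single 3 a, fun v => by simp [cubicEval_apply]⟩
  · interval_cases j
    · exact ⟨Pi.single 0 a, fun v => by simp [cubicEval_apply]⟩

/-- The values of a ternary form of degree `3` are given by a coefficient vector. -/
theorem exists_cubicEval_eq_aeval {k : Type*} [Field k] [Algebra k K]
    {F : MvPolynomial (Fin 3) k} (hF : F.IsHomogeneous 3) :
    ∃ c : Fin 10 → K, ∀ v : Fin 3 → K, MvPolynomial.aeval v F = cubicEval v c := by
  have key : ∀ d ∈ F.support, ∃ c : Fin 10 → K, ∀ v : Fin 3 → K,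
      algebraMap k K (F.coeff d) * ∏ i, v i ^ d i = cubicEval v c := by
    intro d hd
    have hdeg : ∑ i, d i = 3 := by
      rw [← Finsupp.degree_eq_sum, Finsupp.degree_eq_weight_one]
      exact hF (MvPolynomial.mem_support_iff.1 hd)
    simp only [Fin.prod_univ_three]
    rw [Fin.sum_univ_three] at hdeg
    exact exists_cubicEval_eq_monomial _ hdeg
  choose! c hc using key
  refine ⟨∑ d ∈ F.support, c d, fun v => ?_⟩
  rw [MvPolynomial.aeval_def, MvPolynomial.eval₂_eq', map_sum]
  exact Finset.sum_congr rfl fun d hd => hc d hd v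

theorem surjective_pi_of_separating {V ι : Type*} [AddCommGroup V] [Module K V] [Fintype ι]
    (φ : ι → V →ₗ[K] K) (h : ∀ i, ∃ v, φ i v ≠ 0 ∧ ∀ j, j ≠ i → φ j v = 0) :
    Function.Surjective (LinearMap.pi φ) := by
  classical
  choose v hv hv' using h
  intro w
  refine ⟨∑ i, (w i / φ i (v i)) • v i, ?_⟩
  ext j
  rw [LinearMap.pi_apply, map_sum, Finset.sum_eq_single j]
  · simp [hv j]
  · intro i _ hij
    simp [hv' i j hij.symm]
  · simp

/-- Separating functionals cut out a subspace of the expected dimension. -/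
theorem finrank_ker_pi_of_separating {m n : ℕ} (φ : Fin n → (Fin m → K) →ₗ[K] K)
    (h : ∀ i, ∃ v, φ i v ≠ 0 ∧ ∀ j, j ≠ i → φ j v = 0) :
    Module.finrank K (LinearMap.ker (LinearMap.pi φ)) + n = m := by
  have := LinearMap.finrank_range_add_finrank_ker (LinearMap.pi φ)
  rw [LinearMap.range_eq_top.2 (surjective_pi_of_separating φ h), finrank_top] at this
  simp only [Module.finrank_fin_fun] at this
  omega

/-- Five points lie on a conic. -/
theorem exists_conic_of_five (p : Fin 5 → Fin 3 → K) :
    ∃ c : Fin 6 → K, c ≠ 0 ∧ ∀ i, conicEval (p i) c = 0 := by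
  have := LinearMap.ker_ne_bot_of_finrank_lt (f := LinearMap.pi fun i => conicEval (p i)) (by simp)
  obtain ⟨c, hc, h0⟩ := (Submodule.ne_bot_iff _).1 this
  exact ⟨c, h0, fun i => congrFun (LinearMap.mem_ker.1 hc) i⟩

/-- The triple product is the determinant of the three vectors: it vanishes exactly when the points
are collinear, and `p ⨯₃ q` serves as the equation of the line through `p` and `q`. -/
theorem cross_dot_expand (p q r : Fin 3 → K) : (p ⨯₃ q) ⬝ᵥ r =
    (p 1 * q 2 - p 2 * q 1) * r 0 + (p 2 * q 0 - p 0 * q 2) * r 1 +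
      (p 0 * q 1 - p 1 * q 0) * r 2 := by
  simp [cross_apply, dotProduct, Fin.sum_univ_three]

/-- Cramer's rule in dimension three. -/
theorem cross_dot_smul_eq (p q r v : Fin 3 → K) : ((p ⨯₃ q) ⬝ᵥ r) • v =
    ((q ⨯₃ r) ⬝ᵥ v) • p + ((r ⨯₃ p) ⬝ᵥ v) • q + ((p ⨯₃ q) ⬝ᵥ v) • r := by
  ext i
  simp only [cross_dot_expand, Pi.add_apply, Pi.smul_apply, smul_eq_mul]
  fin_cases i <;> simp <;> ring

theorem eq_coords {p q r : Fin 3 → K} (h : (p ⨯₃ q) ⬝ᵥ r ≠ 0) (v : Fin 3 → K) :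
    v = (((p ⨯₃ q) ⬝ᵥ r)⁻¹ * ((q ⨯₃ r) ⬝ᵥ v)) • p + (((p ⨯₃ q) ⬝ᵥ r)⁻¹ * ((r ⨯₃ p) ⬝ᵥ v)) • q +
      (((p ⨯₃ q) ⬝ᵥ r)⁻¹ * ((p ⨯₃ q) ⬝ᵥ v)) • r := by
  rw [mul_smul, mul_smul, mul_smul, ← smul_add, ← smul_add, ← cross_dot_smul_eq, inv_smul_smul₀ h]

theorem exists_coords {p q r : Fin 3 → K} (h : (p ⨯₃ q) ⬝ᵥ r ≠ 0) (v : Fin 3 → K) :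
    ∃ x y z : K, v = x • p + y • q + z • r :=
  ⟨_, _, _, eq_coords h v⟩

theorem coords_eq_zero {p q r : Fin 3 → K} (h : (p ⨯₃ q) ⬝ᵥ r ≠ 0) {x y z : K}
    (h0 : x • p + y • q + z • r = 0) : x = 0 ∧ y = 0 ∧ z = 0 := by
  have e (i : Fin 3) : x * p i + y * q i + z * r i = 0 := by simpa using congrFun h0 i
  have e0 := e 0
  have e1 := e 1
  have e2 := e 2
  rw [cross_dot_expand] at h
  refine ⟨?_, ?_, ?_⟩ <;> refine (mul_eq_zero.1 ?_).resolve_right h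
  -- Pairing the relation with `q ⨯₃ r`, `r ⨯₃ p` or `p ⨯₃ q` isolates one coefficient times the
  -- determinant.
  · linear_combination (q 1 * r 2 - q 2 * r 1) * e0 + (q 2 * r 0 - q 0 * r 2) * e1 +
      (q 0 * r 1 - q 1 * r 0) * e2
  · linear_combination (r 1 * p 2 - r 2 * p 1) * e0 + (r 2 * p 0 - r 0 * p 2) * e1 +
      (r 0 * p 1 - r 1 * p 0) * e2
  · linear_combination (p 1 * q 2 - p 2 * q 1) * e0 + (p 2 * q 0 - p 0 * q 2) * e1 +
      (p 0 * q 1 - p 1 * q 0) * e2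

theorem coords_unique {p q r : Fin 3 → K} (h : (p ⨯₃ q) ⬝ᵥ r ≠ 0) {x y z x' y' z' : K}
    (h0 : x • p + y • q + z • r = x' • p + y' • q + z' • r) : x = x' ∧ y = y' ∧ z = z' := by
  have := coords_eq_zero h (x := x - x') (y := y - y') (z := z - z') (by
    rw [sub_smul, sub_smul, sub_smul, ← sub_eq_zero.2 h0]; abel)
  simpa only [sub_eq_zero] using this

theorem exists_cross_dot_ne_zero {p q : Fin 3 → K} (h : p ⨯₃ q ≠ 0) :
    ∃ r, (p ⨯₃ q) ⬝ᵥ r ≠ 0 := by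
  by_contra! h'
  exact h (dotProduct_eq_zero _ h')

/-- Two non-proportional vectors span the line through the corresponding points. -/
theorem exists_coords_of_collinear {n p q v : Fin 3 → K} (hn : n ≠ 0) (hpq : p ⨯₃ q ≠ 0)
    (hp : n ⬝ᵥ p = 0) (hq : n ⬝ᵥ q = 0) (hv : n ⬝ᵥ v = 0) : ∃ x y : K, v = x • p + y • q := by
  obtain ⟨r, hr⟩ := exists_cross_dot_ne_zero hpq
  obtain ⟨x, y, z, rfl⟩ := exists_coords hr v
  simp only [dotProduct_add, dotProduct_smul, hp, hq, smul_eq_mul, mul_zero, zero_add] at hv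
  rcases mul_eq_zero.1 hv with rfl | h
  · exact ⟨x, y, by simp⟩
  · refine absurd (dotProduct_eq_zero n fun w => ?_) hn
    obtain ⟨a, b, c, rfl⟩ := exists_coords hr w
    simp [dotProduct_add, dotProduct_smul, hp, hq, h]

theorem cross_eq_zero_of_smul (a : K) (p : Fin 3 → K) : p ⨯₃ (a • p) = 0 := by
  simp

theorem cross_ne_zero_of_not_proportional {p q : Fin 3 → K} (hp : p ≠ 0)
    (h : ∀ a : K, a • p ≠ q) : p ⨯₃ q ≠ 0 := by
  intro h0
  have e0 : p 1 * q 2 - p 2 * q 1 = 0 := by simpa [cross_apply] using congrFun h0 0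
  have e1 : p 2 * q 0 - p 0 * q 2 = 0 := by simpa [cross_apply] using congrFun h0 1
  have e2 : p 0 * q 1 - p 1 * q 0 = 0 := by simpa [cross_apply] using congrFun h0 2
  obtain ⟨i, hi⟩ := Function.ne_iff.1 hp
  simp only [Pi.zero_apply] at hi
  refine h (q i / p i) (funext fun j => ?_)
  rw [Pi.smul_apply, smul_eq_mul, div_mul_eq_mul_div, div_eq_iff hi]
  fin_cases i <;> fin_cases j <;> simp only [Fin.zero_eta, Fin.mk_one, Fin.reduceFinMk] <;>
    first
      | ring1
      | linear_combination e0
      | linear_combination e1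
      | linear_combination e2
      | linear_combination -e0
      | linear_combination -e1
      | linear_combination -e2

end PlaneForms

/-! ### Separating points by conics and cubics. -/

section GeneralPosition

open scoped Matrix

variable {K : Type*} [Field K]

@[simp]
theorem cross_dot_left (p q : Fin 3 → K) : (p ⨯₃ q) ⬝ᵥ p = 0 := by
  rw [cross_dot_expand]; ring

@[simp]
theorem cross_dot_right (p q : Fin 3 → K) : (p ⨯₃ q) ⬝ᵥ q = 0 := by
  rw [cross_dot_expand]; ring

/-- The vectors `p i` represent distinct points of the plane, no four of which are collinear. -/
structure NoFourCollinear {ι : Type*} (p : ι → Fin 3 → K) : Prop where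
  cross_ne_zero : ∀ i j, i ≠ j → p i ⨯₃ p j ≠ 0
  eq_zero : ∀ g : Fin 4 → ι, g.Injective → ∀ n : Fin 3 → K, (∀ i, n ⬝ᵥ p (g i) = 0) → n = 0

theorem NoFourCollinear.comp {ι κ : Type*} {p : ι → Fin 3 → K} (h : NoFourCollinear p)
    {g : κ → ι} (hg : g.Injective) : NoFourCollinear fun i => p (g i) where
  cross_ne_zero _ _ hij := h.cross_ne_zero _ _ fun he => hij (hg he)
  eq_zero f hf := h.eq_zero (fun i => g (f i)) (hg.comp hf)

theorem NoFourCollinear.false_of_cross {ι : Type*} {p : ι → Fin 3 → K} (h : NoFourCollinear p)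
    {i j k l : ι} (hinj : Function.Injective ![i, j, k, l])
    (hk : (p i ⨯₃ p j) ⬝ᵥ p k = 0) (hl : (p i ⨯₃ p j) ⬝ᵥ p l = 0) : False := by
  refine h.cross_ne_zero i j (fun hij => ?_) (h.eq_zero _ hinj _ fun t => ?_)
  · exact absurd (@hinj 0 1 (by simpa using hij)) (by decide)
  · fin_cases t
    · simp
    · simp
    · exact hk
    · exact hl

theorem cross_dot_rotate {p q r : Fin 3 → K} (h : (p ⨯₃ q) ⬝ᵥ r = 0) : (r ⨯₃ p) ⬝ᵥ q = 0 := by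
  rw [cross_dot_expand] at h ⊢
  linear_combination h

theorem cross_dot_swap {p q r : Fin 3 → K} (h : (p ⨯₃ q) ⬝ᵥ r = 0) : (q ⨯₃ p) ⬝ᵥ r = 0 := by
  rw [cross_dot_expand] at h ⊢
  linear_combination -h

/-- Among five points, no four of them collinear, the first is separated by a conic from the
others. -/
theorem exists_conic_separating_zero {p : Fin 5 → Fin 3 → K} (h : NoFourCollinear p) :
    ∃ c, conicEval (p 0) c ≠ 0 ∧ ∀ j, j ≠ 0 → conicEval (p j) c = 0 := by
  -- The conic is one of the line pairs 12·34 and 13·24. If both contain point 0, then one line from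
  -- each pair passes through it. These two lines also share a second point, so they coincide and
  -- contain four of the points.
  by_cases h1 : (p 1 ⨯₃ p 2) ⬝ᵥ p 0 ≠ 0 ∧ (p 3 ⨯₃ p 4) ⬝ᵥ p 0 ≠ 0
  · obtain ⟨c, hc⟩ := exists_conicEval_eq_mul (p 1 ⨯₃ p 2) (p 3 ⨯₃ p 4)
    refine ⟨c, by rw [hc]; exact mul_ne_zero h1.1 h1.2, fun j hj => ?_⟩
    rw [hc]
    fin_cases j <;> simp at hj ⊢
  by_cases h2 : (p 1 ⨯₃ p 3) ⬝ᵥ p 0 ≠ 0 ∧ (p 2 ⨯₃ p 4) ⬝ᵥ p 0 ≠ 0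
  · obtain ⟨c, hc⟩ := exists_conicEval_eq_mul (p 1 ⨯₃ p 3) (p 2 ⨯₃ p 4)
    refine ⟨c, by rw [hc]; exact mul_ne_zero h2.1 h2.2, fun j hj => ?_⟩
    rw [hc]
    fin_cases j <;> simp at hj ⊢
  rw [not_and_or, not_ne_iff, not_ne_iff] at h1 h2
  exfalso
  rcases h1 with h1 | h1 <;> rcases h2 with h2 | h2
  · exact h.false_of_cross (i := 0) (j := 1) (k := 2) (l := 3) (by decide)
      (cross_dot_rotate h1) (cross_dot_rotate h2)
  · exact h.false_of_cross (i := 0) (j := 2) (k := 1) (l := 4) (by decide)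
      (cross_dot_rotate (cross_dot_swap h1)) (cross_dot_rotate h2)
  · exact h.false_of_cross (i := 0) (j := 3) (k := 4) (l := 1) (by decide)
      (cross_dot_rotate h1) (cross_dot_rotate (cross_dot_swap h2))
  · exact h.false_of_cross (i := 0) (j := 4) (k := 3) (l := 2) (by decide)
      (cross_dot_rotate (cross_dot_swap h1)) (cross_dot_rotate (cross_dot_swap h2))

theorem exists_conic_separating {p : Fin 5 → Fin 3 → K} (h : NoFourCollinear p) (i : Fin 5) :
    ∃ c, conicEval (p i) c ≠ 0 ∧ ∀ j, j ≠ i → conicEval (p j) c = 0 := by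
  obtain ⟨c, hc, hc'⟩ := exists_conic_separating_zero (h.comp (add_right_injective i))
  refine ⟨c, by simpa using hc, fun j hj => ?_⟩
  simpa using hc' (j - i) (sub_ne_zero.2 hj)

/-- There is only one conic through five points, no four of them collinear. -/
theorem conic_unique {p : Fin 5 → Fin 3 → K} (h : NoFourCollinear p) {c d : Fin 6 → K}
    (hc0 : c ≠ 0) (hc : ∀ i, conicEval (p i) c = 0) (hd : ∀ i, conicEval (p i) d = 0) :
    ∃ a : K, d = a • c := by
  have hrank := finrank_ker_pi_of_separating (fun i => conicEval (p i)) (exists_conic_separating h)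
  have h1 : Module.finrank K (LinearMap.ker (LinearMap.pi fun i => conicEval (p i))) = 1 := by
    omega
  have hc' : c ∈ LinearMap.ker (LinearMap.pi fun i => conicEval (p i)) :=
    LinearMap.mem_ker.2 (funext hc)
  have hd' : d ∈ LinearMap.ker (LinearMap.pi fun i => conicEval (p i)) :=
    LinearMap.mem_ker.2 (funext hd)
  obtain ⟨a, ha⟩ := (finrank_eq_one_iff_of_nonzero' (⟨c, hc'⟩ : LinearMap.ker _)
    (by simpa using hc0)).1 h1 ⟨d, hd'⟩
  exact ⟨a, by simpa using (congrArg Subtype.val ha).symm⟩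

/-- No conic contains seven of the points represented by the vectors `p i`. -/
def NoSevenOnConic {ι : Type*} (p : ι → Fin 3 → K) : Prop :=
  ∀ g : Fin 7 → ι, g.Injective → ∀ c : Fin 6 → K, (∀ i, conicEval (p (g i)) c = 0) → c = 0

theorem NoSevenOnConic.comp {ι κ : Type*} {p : ι → Fin 3 → K} (h : NoSevenOnConic p)
    {g : κ → ι} (hg : g.Injective) : NoSevenOnConic fun i => p (g i) :=
  fun f hf => h (fun i => g (f i)) (hg.comp hf)

theorem exists_cubic_separating_of_not_collinear {p : Fin 8 → Fin 3 → K}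
    (h4 : NoFourCollinear p) (h7 : NoSevenOnConic p) (h2 : (p 0 ⨯₃ p 1) ⬝ᵥ p 2 ≠ 0)
    (h3 : (p 0 ⨯₃ p 1) ⬝ᵥ p 3 ≠ 0) :
    ∃ c, cubicEval (p 0) c ≠ 0 ∧ ∀ j, j ≠ 0 → cubicEval (p j) c = 0 := by
  obtain ⟨q, hq0, hq⟩ := exists_conic_of_five fun i => p (![3, 4, 5, 6, 7] i)
  obtain ⟨r, hr0, hr⟩ := exists_conic_of_five fun i => p (![2, 4, 5, 6, 7] i)
  by_cases hq1 : conicEval (p 0) q = 0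
  · by_cases hr1 : conicEval (p 0) r = 0
    · obtain ⟨a, rfl⟩ := conic_unique (h4.comp (g := ![0, 4, 5, 6, 7]) (by decide)) (c := q)
        (d := r) hq0
        (by
          intro i
          fin_cases i
          exacts [hq1, hq 1, hq 2, hq 3, hq 4])
        (by
          intro i
          fin_cases i
          exacts [hr1, hr 1, hr 2, hr 3, hr 4])
      refine absurd (h7 ![0, 2, 3, 4, 5, 6, 7] (by decide) (a • q) fun i => ?_) hr0
      fin_cases i
      exacts [hr1, hr 0, by simpa using Or.inr (hq 0), hr 1, hr 2, hr 3, hr 4]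
    · obtain ⟨c, hc⟩ := exists_cubicEval_eq_mul (p 1 ⨯₃ p 3) r
      refine ⟨c, ?_, fun j hj => ?_⟩
      · rw [hc]
        exact mul_ne_zero (fun h => h3 (cross_dot_rotate h)) hr1
      · rw [hc]
        fin_cases j
        exacts [absurd rfl hj, by simp, mul_eq_zero_of_right _ (hr 0), by simp,
          mul_eq_zero_of_right _ (hr 1), mul_eq_zero_of_right _ (hr 2),
          mul_eq_zero_of_right _ (hr 3), mul_eq_zero_of_right _ (hr 4)]
  · obtain ⟨c, hc⟩ := exists_cubicEval_eq_mul (p 1 ⨯₃ p 2) q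
    refine ⟨c, ?_, fun j hj => ?_⟩
    · rw [hc]
      exact mul_ne_zero (fun h => h2 (cross_dot_rotate h)) hq1
    · rw [hc]
      fin_cases j
      exacts [absurd rfl hj, by simp, by simp, mul_eq_zero_of_right _ (hq 0),
        mul_eq_zero_of_right _ (hq 1), mul_eq_zero_of_right _ (hq 2),
        mul_eq_zero_of_right _ (hq 3), mul_eq_zero_of_right _ (hq 4)]

theorem exists_cubic_separating_zero {p : Fin 8 → Fin 3 → K}
    (h4 : NoFourCollinear p) (h7 : NoSevenOnConic p) :
    ∃ c, cubicEval (p 0) c ≠ 0 ∧ ∀ j, j ≠ 0 → cubicEval (p j) c = 0 := by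
  have reindex (σ : Fin 8 → Fin 8) (hσ : σ.Involutive) (h0 : σ 0 = 0)
      (h2 : (p (σ 0) ⨯₃ p (σ 1)) ⬝ᵥ p (σ 2) ≠ 0) (h3 : (p (σ 0) ⨯₃ p (σ 1)) ⬝ᵥ p (σ 3) ≠ 0) :
      ∃ c, cubicEval (p 0) c ≠ 0 ∧ ∀ j, j ≠ 0 → cubicEval (p j) c = 0 := by
    obtain ⟨c, hc, hc'⟩ := exists_cubic_separating_of_not_collinear (h4.comp hσ.injective)
      (h7.comp hσ.injective) h2 h3
    refine ⟨c, by rwa [h0] at hc, fun j hj => ?_⟩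
    rw [← hσ j]
    exact hc' (σ j) fun hj' => hj (hσ.injective (hj'.trans h0.symm))
  by_cases h2 : (p 0 ⨯₃ p 1) ⬝ᵥ p 2 = 0
  · refine reindex (Equiv.swap 2 4) (fun i => by simp) (by decide)
      (fun h => h4.false_of_cross (i := 0) (j := 1) (k := 2) (l := 4) (by decide) h2 h)
      (fun h => h4.false_of_cross (i := 0) (j := 1) (k := 2) (l := 3) (by decide) h2 h)
  by_cases h3 : (p 0 ⨯₃ p 1) ⬝ᵥ p 3 = 0
  · refine reindex (Equiv.swap 3 4) (fun i => by simp) (by decide) h2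
      (fun h => h4.false_of_cross (i := 0) (j := 1) (k := 3) (l := 4) (by decide) h3 h)
  · exact exists_cubic_separating_of_not_collinear h4 h7 h2 h3

theorem exists_cubic_separating {p : Fin 8 → Fin 3 → K}
    (h4 : NoFourCollinear p) (h7 : NoSevenOnConic p) (i : Fin 8) :
    ∃ c, cubicEval (p i) c ≠ 0 ∧ ∀ j, j ≠ i → cubicEval (p j) c = 0 := by
  obtain ⟨c, hc, hc'⟩ := exists_cubic_separating_zero (h4.comp (add_right_injective i))
    (h7.comp (add_right_injective i))
  refine ⟨c, by simpa using hc, fun j hj => ?_⟩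
  simpa using hc' (j - i) (sub_ne_zero.2 hj)

/-- If no four of eight points are collinear and no seven of them lie on a conic, then the cubics
through the eight points form a pencil. -/
theorem cubic_mem_pencil {p : Fin 8 → Fin 3 → K} (h4 : NoFourCollinear p)
    (h7 : NoSevenOnConic p) {c d e : Fin 10 → K} (hli : LinearIndependent K ![c, d])
    (hc : ∀ i, cubicEval (p i) c = 0) (hd : ∀ i, cubicEval (p i) d = 0)
    (he : ∀ i, cubicEval (p i) e = 0) : ∃ a b : K, e = a • c + b • d := by
  -- Eight independent conditions on ten coefficients leave dimension two.
  have hrank := finrank_ker_pi_of_separating (fun i => cubicEval (p i))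
    (exists_cubic_separating h4 h7)
  set W := LinearMap.ker (LinearMap.pi fun i => cubicEval (p i)) with hW
  have hle : Submodule.span K (Set.range ![c, d]) ≤ W := by
    rw [Submodule.span_le]
    rintro _ ⟨i, rfl⟩
    fin_cases i
    exacts [LinearMap.mem_ker.2 (funext hc), LinearMap.mem_ker.2 (funext hd)]
  have heq : Submodule.span K (Set.range ![c, d]) = W := by
    refine Submodule.eq_of_le_of_finrank_eq hle ?_
    rw [finrank_span_eq_card hli, Fintype.card_fin]
    omega
  have heW : e ∈ W := LinearMap.mem_ker.2 (funext he)
  rw [← heq, Matrix.range_cons, Matrix.range_cons, Matrix.range_empty, Set.union_empty,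
    Set.singleton_union, Submodule.mem_span_pair] at heW
  obtain ⟨a, b, hab⟩ := heW
  exact ⟨a, b, hab.symm⟩

end GeneralPosition

/-! ### Infinite families of points on lines, conics and cubics. -/

section CurveFamilies

open scoped Matrix

variable {K : Type*} [Field K]

/-- The vectors `v t` are nonzero and represent pairwise distinct points of the plane. -/
structure DistinctPoints {ι : Type*} (v : ι → Fin 3 → K) : Prop where
  ne_zero : ∀ t, v t ≠ 0
  eq_of_smul_eq : ∀ (t t' : ι) (a : K), a • v t = v t' → t = t'

theorem smul_add_smul_cross (p q : Fin 3 → K) (x y x' y' : K) :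
    (x • p + y • q) ⨯₃ (x' • p + y' • q) = (x * y' - y * x') • (p ⨯₃ q) := by
  ext i
  fin_cases i <;> simp [cross_apply] <;> ring

/-- A line containing four common points of some cubics is contained in all of them. -/
theorem exists_family_of_collinear {p : Fin 4 → Fin 3 → K}
    (hp : ∀ i j, i ≠ j → p i ⨯₃ p j ≠ 0) {n : Fin 3 → K} (hn : n ≠ 0)
    (hnp : ∀ i, n ⬝ᵥ p i = 0) :
    ∃ v : K → Fin 3 → K, DistinctPoints v ∧
      ∀ c, (∀ i, cubicEval (p i) c = 0) → ∀ t, cubicEval (v t) c = 0 := by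
  have h01 := hp 0 1 (by decide)
  obtain ⟨r, hr⟩ := exists_cross_dot_ne_zero h01
  obtain ⟨x, y, h2⟩ := exists_coords_of_collinear hn h01 (hnp 0) (hnp 1) (hnp 2)
  obtain ⟨x', y', h3⟩ := exists_coords_of_collinear hn h01 (hnp 0) (hnp 1) (hnp 3)
  have hx : x ≠ 0 := by
    rintro rfl
    exact hp 1 2 (by decide) (by rw [h2]; simp)
  have hy : y ≠ 0 := by
    rintro rfl
    exact hp 0 2 (by decide) (by rw [h2]; simp)
  have hx' : x' ≠ 0 := by
    rintro rfl
    exact hp 1 3 (by decide) (by rw [h3]; simp)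
  have hy' : y' ≠ 0 := by
    rintro rfl
    exact hp 0 3 (by decide) (by rw [h3]; simp)
  have hdet : x * y' - y * x' ≠ 0 := fun h0 =>
    hp 2 3 (by decide) (by rw [h2, h3, smul_add_smul_cross, h0, zero_smul])
  -- This family runs over the line with `p 1` removed.
  refine ⟨fun t => p 0 + t • p 1, ⟨fun t h => ?_, fun t t' a h => ?_⟩, fun c hc t => ?_⟩
  · have := (coords_eq_zero hr (x := 1) (y := t) (z := 0) (by simpa using h)).1
    exact one_ne_zero this
  · obtain ⟨h1, h2, -⟩ := coords_unique hr (x := a) (y := a * t) (z := 0) (x' := 1) (y' := t')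
      (z' := 0) (by simpa [mul_smul] using h)
    rw [h1, one_mul] at h2
    exact h2
  -- Vanishing at `p 0` and `p 1` reduces the restricted form to `x * y * (d 3 * x + d 5 * y)`. The
  -- other two points kill the linear factor.
  · obtain ⟨d, hd⟩ := exists_cubicEval_comp (p 0) (p 1) 0 c
    have e0 : d 0 = 0 := by simpa [hc 0, cubicEval_apply] using (hd 1 0 0).symm
    have e1 : d 1 = 0 := by simpa [hc 1, cubicEval_apply] using (hd 0 1 0).symm
    have e2 : x * y * (d 3 * x + d 5 * y) = 0 := by
      have := hd x y 0
      rw [smul_zero, add_zero, ← h2, hc 2] at this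
      simp [cubicEval_apply, e0, e1] at this
      linear_combination -this
    have e3 : x' * y' * (d 3 * x' + d 5 * y') = 0 := by
      have := hd x' y' 0
      rw [smul_zero, add_zero, ← h3, hc 3] at this
      simp [cubicEval_apply, e0, e1] at this
      linear_combination -this
    have f2 := (mul_eq_zero.1 e2).resolve_left (mul_ne_zero hx hy)
    have f3 := (mul_eq_zero.1 e3).resolve_left (mul_ne_zero hx' hy')
    have g3 : d 3 = 0 := (mul_eq_zero.1 (show (x * y' - y * x') * d 3 = 0 by
      linear_combination y' * f2 - y * f3)).resolve_left hdet
    have g5 : d 5 = 0 := (mul_eq_zero.1 (show (x * y' - y * x') * d 5 = 0 by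
      linear_combination x * f3 - x' * f2)).resolve_left hdet
    have := hd 1 t 0
    rw [one_smul, smul_zero, add_zero] at this
    rw [this]
    simp [cubicEval_apply, e0, e1, g3, g5]

theorem conic_eq_zero {c : Fin 6 → K} (h : ∀ v, conicEval v c = 0) : c = 0 := by
  have h0 : c 0 = 0 := by simpa [conicEval_apply] using h ![1, 0, 0]
  have h1 : c 1 = 0 := by simpa [conicEval_apply] using h ![0, 1, 0]
  have h2 : c 2 = 0 := by simpa [conicEval_apply] using h ![0, 0, 1]
  have h3 : c 3 = 0 := by simpa [conicEval_apply, h1, h2] using h ![0, 1, 1]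
  have h4 : c 4 = 0 := by simpa [conicEval_apply, h0, h2] using h ![1, 0, 1]
  have h5 : c 5 = 0 := by simpa [conicEval_apply, h0, h1] using h ![1, 1, 0]
  ext i
  fin_cases i
  exacts [h0, h1, h2, h3, h4, h5]

/-- Seven points, no four of them collinear, do not lie on a pair of lines. -/
theorem conic_eq_zero_of_eq_mul {p : Fin 7 → Fin 3 → K} (h4 : NoFourCollinear p)
    {c : Fin 6 → K} (hc : ∀ i, conicEval (p i) c = 0) {m n : Fin 3 → K}
    (hmn : ∀ v, conicEval v c = m ⬝ᵥ v * n ⬝ᵥ v) : c = 0 := by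
  classical
  -- Pigeonhole: of seven points on two lines, four lie on the same one.
  obtain ⟨b, hb⟩ := Fintype.exists_lt_card_fiber_of_mul_lt_card (n := 3)
    (fun i : Fin 7 => decide (m ⬝ᵥ p i = 0)) (by simp)
  have hg := Finset.orderEmbOfCardLe_mem _ (Nat.succ_le_of_lt hb)
  set g := Finset.orderEmbOfCardLe _ (Nat.succ_le_of_lt hb)
  cases b
  · have hn := h4.eq_zero g g.injective n fun i =>
      (mul_eq_zero.1 ((hmn _).symm.trans (hc (g i)))).resolve_left (by simpa using hg i)
    exact conic_eq_zero fun v => by rw [hmn, hn, zero_dotProduct, mul_zero]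
  · have hm := h4.eq_zero g g.injective m fun i => by simpa using hg i
    exact conic_eq_zero fun v => by rw [hmn, hm, zero_dotProduct, zero_mul]

/-- The parametrization of the conic `a * y * z + b * x * z + c * x * y = 0` in the coordinate
system given by `p`, `q`, `r`. -/
def conicParam (p q r : Fin 3 → K) (a b c t : K) : Fin 3 → K :=
  (-a * t * (1 + t)) • p + (-b * (1 + t)) • q + (c * t) • r

/-- The coordinates along `q` and `r` already determine `t`: the relations `s * t = t'` and `s * (1
+ t) = 1 + t'` force `s = 1`. -/
theorem distinctPoints_conicParam {p q r : Fin 3 → K} (h : (p ⨯₃ q) ⬝ᵥ r ≠ 0) {a b c : K}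
    (hb : b ≠ 0) (hc : c ≠ 0) : DistinctPoints (conicParam p q r a b c) where
  ne_zero t h0 := by
    obtain ⟨-, h1, h2⟩ := coords_eq_zero h h0
    have ht : t = 0 := by simpa [hc] using h2
    simp [ht, hb] at h1
  eq_of_smul_eq t t' s h0 := by
    simp only [conicParam, smul_add, smul_smul] at h0
    obtain ⟨-, h1, h2⟩ := coords_unique h h0
    have h2' : s * t = t' := mul_left_cancel₀ hc (by linear_combination h2)
    have h1' : s * (1 + t) = 1 + t' := mul_left_cancel₀ hb (by linear_combination -h1)
    have hs : s = 1 := by linear_combination h1' - h2'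
    rw [← h2', hs, one_mul]

/-- Points of the conic outside the coordinate triangle are in the image of the
parametrization. -/
theorem exists_conicParam_eq {p q r : Fin 3 → K} {a b c x y z : K} (ha : a ≠ 0) (hb : b ≠ 0)
    (hc : c ≠ 0) (hx : x ≠ 0) (hy : y ≠ 0) (hz : z ≠ 0)
    (h0 : a * (y * z) + b * (x * z) + c * (x * y) = 0) :
    ∃ t s : K, t ≠ 0 ∧ 1 + t ≠ 0 ∧ s ≠ 0 ∧
      conicParam p q r a b c t = s • (x • p + y • q + z • r) := by
  have ht : 1 + b * x / (a * y) = -(c * x) / (a * z) := by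
    field_simp
    linear_combination h0
  -- Dividing by `x * y * z` turns the conic into the line a/x + b/y + c/z = 0 in the inverse
  -- coordinates. The parameter `t` is the ratio of the second term to the first.
  refine ⟨b * x / (a * y), b * c * x / (a * y * z), by positivity, ?_, by positivity, ?_⟩
  · rw [ht]
    exact div_ne_zero (neg_ne_zero.2 (mul_ne_zero hc hx)) (mul_ne_zero ha hz)
  · rw [conicParam, ht, smul_add, smul_add, smul_smul, smul_smul, smul_smul]
    congr 1
    · congr 1
      · congr 1
        field_simp
      · congr 1
        field_simp
    · congr 1
      field_simp

/-- A cubic through the three vertices of the coordinate triangle and four further points of the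
conic contains the conic. -/
theorem cubicEval_conicParam_eq_zero {p q r : Fin 3 → K} {a b c : K} {e : Fin 10 → K}
    (hp : cubicEval p e = 0) (hq : cubicEval q e = 0) (hr : cubicEval r e = 0)
    {t : Fin 4 → K} (ht : t.Injective) (ht0 : ∀ i, t i ≠ 0) (ht1 : ∀ i, 1 + t i ≠ 0)
    (he : ∀ i, cubicEval (conicParam p q r a b c (t i)) e = 0) (s : K) :
    cubicEval (conicParam p q r a b c s) e = 0 := by
  obtain ⟨f, hf⟩ := exists_cubicEval_comp p q r e
  have f0 : f 0 = 0 := by simpa [hp, cubicEval_apply] using (hf 1 0 0).symm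
  have f1 : f 1 = 0 := by simpa [hq, cubicEval_apply] using (hf 0 1 0).symm
  have f2 : f 2 = 0 := by simpa [hr, cubicEval_apply] using (hf 0 0 1).symm
  -- Vanishing at the three vertices lets `u * (1 + u)` factor out of the pulled-back cubic (`u = 0`
  -- gives `q`, `u = -1` gives `r`) and leaves a cofactor of degree at most 3, which four further
  -- roots annihilate.
  open Polynomial in
  set P : K[X] := C (-f 3 * a ^ 2 * b) * X * (1 + X) ^ 2 + C (f 4 * a ^ 2 * c) * X ^ 2 * (1 + X) +
    C (-f 5 * a * b ^ 2) * (1 + X) ^ 2 + C (f 6 * b ^ 2 * c) * (1 + X) +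
    C (-f 7 * a * c ^ 2) * X ^ 2 + C (-f 8 * b * c ^ 2) * X +
    C (f 9 * a * b * c) * X * (1 + X) with hP
  have key (u : K) : cubicEval (conicParam p q r a b c u) e = u * (1 + u) * P.eval u := by
    rw [conicParam, hf, hP]
    simp [cubicEval_apply, f0, f1, f2]
    ring
  have hP0 : P = 0 := by
    refine Polynomial.eq_zero_of_natDegree_lt_card_of_eval_eq_zero P ht (fun i => ?_) ?_
    · exact (mul_eq_zero.1 ((key _).symm.trans (he i))).resolve_left (mul_ne_zero (ht0 i) (ht1 i))
    · rw [Fintype.card_fin]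
      refine Nat.lt_succ_of_le ?_
      rw [hP]
      compute_degree
  rw [key, hP0, Polynomial.eval_zero, mul_zero]

theorem exists_family_of_conic_of_not_collinear {p : Fin 7 → Fin 3 → K} (h4 : NoFourCollinear p)
    {c : Fin 6 → K} (hc0 : c ≠ 0) (hc : ∀ i, conicEval (p i) c = 0)
    (hD : (p 0 ⨯₃ p 1) ⬝ᵥ p 2 ≠ 0) :
    ∃ v : K → Fin 3 → K, DistinctPoints v ∧
      ∀ e, (∀ i, cubicEval (p i) e = 0) → ∀ t, cubicEval (v t) e = 0 := by
  obtain ⟨d, hd⟩ := exists_conicEval_comp (p 0) (p 1) (p 2) c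
  have d0 : d 0 = 0 := by simpa [hc 0, conicEval_apply] using (hd 1 0 0).symm
  have d1 : d 1 = 0 := by simpa [hc 1, conicEval_apply] using (hd 0 1 0).symm
  have d2 : d 2 = 0 := by simpa [hc 2, conicEval_apply] using (hd 0 0 1).symm
  have hQ (x y z : K) : conicEval (x • p 0 + y • p 1 + z • p 2) c =
      d 3 * (y * z) + d 4 * (x * z) + d 5 * (x * y) := by
    rw [hd]
    simp [conicEval_apply, d0, d1, d2]
  set D := (p 0 ⨯₃ p 1) ⬝ᵥ p 2 with hDdef
  have hQv (v : Fin 3 → K) : conicEval v c = d 3 * ((D⁻¹ * ((p 2 ⨯₃ p 0) ⬝ᵥ v)) *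
      (D⁻¹ * ((p 0 ⨯₃ p 1) ⬝ᵥ v))) + d 4 * ((D⁻¹ * ((p 1 ⨯₃ p 2) ⬝ᵥ v)) *
      (D⁻¹ * ((p 0 ⨯₃ p 1) ⬝ᵥ v))) + d 5 * ((D⁻¹ * ((p 1 ⨯₃ p 2) ⬝ᵥ v)) *
      (D⁻¹ * ((p 2 ⨯₃ p 0) ⬝ᵥ v))) := by
    rw [← hQ, ← eq_coords hD v]
  -- Were one of the three coefficients zero, a coordinate would factor out and the conic would be a
  -- pair of lines.
  have h3 : d 3 ≠ 0 := fun h => hc0 <| conic_eq_zero_of_eq_mul h4 hc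
    (m := p 1 ⨯₃ p 2) (n := (D⁻¹ ^ 2) • (d 4 • (p 0 ⨯₃ p 1) + d 5 • (p 2 ⨯₃ p 0))) fun v => by
      rw [hQv, h]
      simp only [smul_dotProduct, add_dotProduct, smul_eq_mul]
      ring
  have h4' : d 4 ≠ 0 := fun h => hc0 <| conic_eq_zero_of_eq_mul h4 hc
    (m := p 2 ⨯₃ p 0) (n := (D⁻¹ ^ 2) • (d 3 • (p 0 ⨯₃ p 1) + d 5 • (p 1 ⨯₃ p 2))) fun v => by
      rw [hQv, h]
      simp only [smul_dotProduct, add_dotProduct, smul_eq_mul]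
      ring
  have h5 : d 5 ≠ 0 := fun h => hc0 <| conic_eq_zero_of_eq_mul h4 hc
    (m := p 0 ⨯₃ p 1) (n := (D⁻¹ ^ 2) • (d 3 • (p 2 ⨯₃ p 0) + d 4 • (p 1 ⨯₃ p 2))) fun v => by
      rw [hQv, h]
      simp only [smul_dotProduct, add_dotProduct, smul_eq_mul]
      ring
  have hpt (i : Fin 7) (i0 : 0 ≠ i) (i1 : 1 ≠ i) (i2 : 2 ≠ i) : ∃ t s : K, t ≠ 0 ∧ 1 + t ≠ 0 ∧
      s ≠ 0 ∧ conicParam (p 0) (p 1) (p 2) (d 3) (d 4) (d 5) t = s • p i := by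
    obtain ⟨x, y, z, hxyz⟩ := exists_coords hD (p i)
    have n0 := h4.cross_ne_zero _ _ i0
    have n1 := h4.cross_ne_zero _ _ i1
    have n2 := h4.cross_ne_zero _ _ i2
    have hi := hc i
    rw [hxyz] at n0 n1 n2 hi
    rw [hQ] at hi
    rw [hxyz]
    have hx : x ≠ 0 := by
      rintro rfl
      have : y = 0 ∨ z = 0 := by simpa [h3] using hi
      rcases this with rfl | rfl
      · simp at n2
      · simp at n1
    have hy : y ≠ 0 := by
      rintro rfl
      have : x = 0 ∨ z = 0 := by simpa [h4'] using hi
      rcases this with rfl | rfl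
      · simp at n2
      · simp at n0
    have hz : z ≠ 0 := by
      rintro rfl
      have : x = 0 ∨ y = 0 := by simpa [h5] using hi
      rcases this with rfl | rfl
      · simp at n1
      · simp at n0
    exact exists_conicParam_eq h3 h4' h5 hx hy hz hi
  -- The four points besides the triangle have indices 3 to 6.
  have hι : ∀ i : Fin 4, 0 ≠ (Fin.natAdd 3 i : Fin 7) ∧ 1 ≠ (Fin.natAdd 3 i : Fin 7) ∧
    2 ≠ (Fin.natAdd 3 i : Fin 7) := by decide
  choose t s ht0 ht1 hs ht using fun i : Fin 4 =>
    hpt (Fin.natAdd 3 i) (hι i).1 (hι i).2.1 (hι i).2.2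
  refine ⟨_, distinctPoints_conicParam hD (a := d 3) h4' h5, fun e he u =>
    cubicEval_conicParam_eq_zero (he 0) (he 1) (he 2) (t := t) (fun i j hij => ?_) ht0 ht1
      (fun i => ?_) u⟩
  · by_contra hne
    refine h4.cross_ne_zero (Fin.natAdd 3 i) (Fin.natAdd 3 j)
      (fun h => hne (Fin.natAdd_injective 4 3 h)) ?_
    have : p (Fin.natAdd 3 j) = ((s j)⁻¹ * s i) • p (Fin.natAdd 3 i) := by
      rw [mul_smul, ← ht i, hij, ht j, inv_smul_smul₀ (hs j)]
    rw [this, cross_eq_zero_of_smul]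
  · rw [ht, cubicEval_smul, he, mul_zero]

/-- A conic containing seven common points of some cubics, no four of them collinear, is contained
in all of these cubics. -/
theorem exists_family_of_conic {p : Fin 7 → Fin 3 → K} (h4 : NoFourCollinear p)
    {c : Fin 6 → K} (hc0 : c ≠ 0) (hc : ∀ i, conicEval (p i) c = 0) :
    ∃ v : K → Fin 3 → K, DistinctPoints v ∧
      ∀ e, (∀ i, cubicEval (p i) e = 0) → ∀ t, cubicEval (v t) e = 0 := by
  by_cases h2 : (p 0 ⨯₃ p 1) ⬝ᵥ p 2 = 0
  · obtain ⟨v, hv, hv'⟩ := exists_family_of_conic_of_not_collinear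
      (h4.comp (Equiv.swap (2 : Fin 7) 3).injective) hc0 (fun i => hc _)
      (fun h => h4.false_of_cross (i := 0) (j := 1) (k := 2) (l := 3) (by decide) h2 h)
    exact ⟨v, hv, fun e he => hv' e fun i => he _⟩
  · exact exists_family_of_conic_of_not_collinear h4 hc0 hc h2

/-- A cubic curve over an algebraically closed field has infinitely many points. -/
theorem exists_family_of_cubic [IsAlgClosed K] {c : Fin 10 → K} {o : Fin 3 → K}
    (ho : cubicEval o c ≠ 0) :
    ∃ v : K → Fin 3 → K, DistinctPoints v ∧ ∀ t, cubicEval (v t) c = 0 := by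
  have ho0 : o ≠ 0 := by
    rintro rfl
    simp [cubicEval_apply] at ho
  obtain ⟨q, hq⟩ : ∃ q, o ⨯₃ q ≠ 0 := by
    by_contra! h
    refine ho0 (dotProduct_eq_zero o fun w => ?_)
    have e0 := congrFun (h ![1, 0, 0])
    have e1 := congrFun (h ![0, 1, 0])
    have e00 : o 2 = 0 := by simpa [cross_apply] using e0 1
    have e01 : o 1 = 0 := by simpa [cross_apply] using e0 2
    have e02 : o 0 = 0 := by simpa [cross_apply] using e1 2
    simp [dotProduct, Fin.sum_univ_three, e00, e01, e02]
  obtain ⟨r, hr⟩ := exists_cross_dot_ne_zero hq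
  obtain ⟨d, hd⟩ := exists_cubicEval_comp o q r c
  have d0 : d 0 ≠ 0 := by
    have := hd 1 0 0
    simp [cubicEval_apply] at this ho
    rwa [this] at ho
  -- Projection from `o`, a point off the curve: on the line joining `o` to `q + a • r` the equation
  -- is a cubic in `s` with leading coefficient `d 0`, the value at `o`.
  have hroot (a : K) : ∃ s : K, cubicEval (s • o + (1 : K) • q + a • r) c = 0 := by
    obtain ⟨s, hs⟩ := IsAlgClosed.exists_root (Cubic.toPoly ⟨d 0, d 3 + d 4 * a,
      d 5 + d 7 * a ^ 2 + d 9 * a, d 1 + d 2 * a ^ 3 + d 6 * a + d 8 * a ^ 2⟩)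
      (by rw [Cubic.degree_of_a_ne_zero d0]; decide)
    refine ⟨s, ?_⟩
    simp [Cubic.toPoly] at hs
    rw [hd]
    simp [cubicEval_apply]
    linear_combination hs
  choose s hs using hroot
  refine ⟨fun a => s a • o + (1 : K) • q + a • r, ⟨fun a h => ?_, fun a a' u h => ?_⟩, hs⟩
  · exact one_ne_zero (coords_eq_zero hr h).2.1
  · simp only [smul_add, smul_smul] at h
    obtain ⟨-, h1, h2⟩ := coords_unique hr h
    rw [mul_one] at h1
    rwa [h1, one_mul] at h2

end CurveFamilies

/-! ### From coefficient vectors back to loci in the projective plane. -/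

section CayleyBacharach

variable {k K : Type*} [Field k] [Field K] [Algebra k K]

theorem infinite_of_distinctPoints [Infinite K] {F₁ F₂ : MvPolynomial (Fin 3) k} {m n : ℕ}
    (hF₁ : F₁.IsHomogeneous m) (hF₂ : F₂.IsHomogeneous n) {v : K → Fin 3 → K}
    (hv : DistinctPoints v) (h₁ : ∀ t, MvPolynomial.aeval (v t) F₁ = 0)
    (h₂ : ∀ t, MvPolynomial.aeval (v t) F₂ = 0) :
    (planeLocus K F₁ ∩ planeLocus K F₂).Infinite := by
  refine (Set.infinite_range_of_injective
    (f := fun t => Projectivization.mk K (v t) (hv.ne_zero t)) fun t t' h => ?_).mono ?_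
  · obtain ⟨a, ha⟩ := (Projectivization.mk_eq_mk_iff' K _ _ _ _).1 h
    exact (hv.eq_of_smul_eq _ _ a ha).symm
  · rintro _ ⟨t, rfl⟩
    exact ⟨(mk_mem_planeLocus_iff hF₁ _ _).2 (h₁ t), (mk_mem_planeLocus_iff hF₂ _ _).2 (h₂ t)⟩

theorem aeval_rep_of_mem_planeLocus {F : MvPolynomial (Fin 3) k} {P : ℙ K (Fin 3 → K)}
    (h : P ∈ planeLocus K F) : MvPolynomial.aeval P.rep F = 0 :=
  h P.rep P.rep_nonzero P.mk_rep

theorem exists_aeval_ne_zero [Infinite K] {F : MvPolynomial (Fin 3) k} (hF : F ≠ 0) :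
    ∃ v : Fin 3 → K, MvPolynomial.aeval v F ≠ 0 := by
  by_contra! h
  refine hF (MvPolynomial.map_injective _ (algebraMap k K).injective ?_)
  rw [map_zero]
  refine MvPolynomial.funext fun v => ?_
  rw [map_zero, MvPolynomial.eval_map, ← MvPolynomial.aeval_def, h]

end CayleyBacharach

theorem theorem9p4 {k K : Type*} [Field k] [Field K] [IsAlgClosed K] [Algebra k K]
    (F₁ F₂ : MvPolynomial (Fin 3) k) (hF₁ : IsCubicForm F₁) (hF₂ : IsCubicForm F₂)
    (hnine : (planeLocus K F₁ ∩ planeLocus K F₂).ncard = 9)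
    (G : MvPolynomial (Fin 3) k) (hG : IsCubicForm G)
    (S : Set (ℙ K (Fin 3 → K))) (hS : S ⊆ planeLocus K F₁ ∩ planeLocus K F₂)
    (hScard : S.ncard = 8) (hSG : S ⊆ planeLocus K G) :
    planeLocus K F₁ ∩ planeLocus K F₂ ⊆ planeLocus K G := by
  have : Infinite K := IsAlgClosed.instInfinite
  -- An infinite set has `ncard` 0, so `ncard = 9` yields finiteness.
  have hfin : (planeLocus K F₁ ∩ planeLocus K F₂).Finite :=
    Set.finite_of_ncard_ne_zero (by rw [hnine]; decide)
  obtain ⟨c, hc⟩ := exists_cubicEval_eq_aeval (K := K) hF₁.2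
  obtain ⟨d, hd⟩ := exists_cubicEval_eq_aeval (K := K) hF₂.2
  obtain ⟨e, he⟩ := exists_cubicEval_eq_aeval (K := K) hG.2
  have hno (v : K → Fin 3 → K) (hv : DistinctPoints v) (h₁ : ∀ t, cubicEval (v t) c = 0)
      (h₂ : ∀ t, cubicEval (v t) d = 0) : False :=
    infinite_of_distinctPoints hF₁.2 hF₂.2 hv (fun t => (hc _).trans (h₁ t))
      (fun t => (hd _).trans (h₂ t)) hfin
  have hSfin : S.Finite := hfin.subset hS
  have : Finite S := hSfin
  let σ : S ≃ Fin 8 := Finite.equivFinOfCardEq ((Nat.card_coe_set_eq S).trans hScard)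
  let p : Fin 8 → Fin 3 → K := fun i => (σ.symm i).1.rep
  have hpc (i) : cubicEval (p i) c = 0 :=
    (hc _).symm.trans (aeval_rep_of_mem_planeLocus (hS (σ.symm i).2).1)
  have hpd (i) : cubicEval (p i) d = 0 :=
    (hd _).symm.trans (aeval_rep_of_mem_planeLocus (hS (σ.symm i).2).2)
  have hpe (i) : cubicEval (p i) e = 0 :=
    (he _).symm.trans (aeval_rep_of_mem_planeLocus (hSG (σ.symm i).2))
  have hcross (i j) (hij : i ≠ j) : crossProduct (p i) (p j) ≠ 0 := by
    refine cross_ne_zero_of_not_proportional (Projectivization.rep_nonzero _) fun a ha => hij ?_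
    refine σ.symm.injective (Subtype.ext ?_)
    rw [← Projectivization.mk_rep (σ.symm i).1, ← Projectivization.mk_rep (σ.symm j).1]
    exact ((Projectivization.mk_eq_mk_iff' K _ _ _ _).2 ⟨a, ha⟩).symm
  have h4 : NoFourCollinear p := by
    refine ⟨hcross, fun g hg n hn => by_contra fun hn0 => ?_⟩
    obtain ⟨v, hv, hv'⟩ := exists_family_of_collinear (p := fun i => p (g i))
      (fun i j hij => hcross _ _ (hg.ne hij)) hn0 hn
    exact hno v hv (hv' c fun i => hpc _) (hv' d fun i => hpd _)
  have h7 : NoSevenOnConic p := by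
    refine fun g hg q hq => by_contra fun hq0 => ?_
    obtain ⟨v, hv, hv'⟩ := exists_family_of_conic (h4.comp hg) hq0 hq
    exact hno v hv (hv' c fun i => hpc _) (hv' d fun i => hpd _)
  have hli : LinearIndependent K ![c, d] := by
    obtain ⟨o, ho⟩ := exists_aeval_ne_zero (K := K) hF₂.1
    rw [hd] at ho
    have hd0 : d ≠ 0 := by
      rintro rfl
      simp at ho
    -- If `c = a • d`, every point of the second cubic would lie on the first.
    rw [LinearIndependent.pair_symm_iff, LinearIndependent.pair_iff' hd0]
    rintro a rfl
    obtain ⟨v, hv, hv'⟩ := exists_family_of_cubic ho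
    exact hno v hv (fun t => by rw [map_smul, hv', smul_zero]) hv'
  obtain ⟨a, b, rfl⟩ := cubic_mem_pencil h4 h7 hli hpc hpd hpe
  intro P hP
  rw [← P.mk_rep, mk_mem_planeLocus_iff hG.2, he, map_add, map_smul, map_smul, ← hc, ← hd,
    aeval_rep_of_mem_planeLocus hP.1, aeval_rep_of_mem_planeLocus hP.2, smul_zero, smul_zero,
    add_zero]
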